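/- **Theorem 1.1.** A *weight* on $\mathbb{Z}$ is a function $\omega\colon\mathbb{Z}\to[1,\infty)$ with $\omega(0)=1$ and $\omega(m+n)\le\omega(m)\,\omega(n)$ for all $m,n\in\mathbb{Z}$. For a weight $\omega$ on $\mathbb{Z}$, let $$\ell^1(\mathbb{Z},\omega)=\Bigl\{f\colon\mathbb{Z}\to\mathbb{C} : \|f\|_\omega=\sum_{n\in\mathbb{Z}}|f(n)|\,\omega(n)<\infty\Bigr\},$$ a unital Banach algebra under the convolution $(f*g)(n)=\sum_{m\in\mathbb{Z}}f(m)\,g(n-m)$. Equip its bidual $\ell^1(\mathbb{Z},\omega)''$ with the first Arens product $\Box$, which for a Banach algebra $A$ is defined by $$\langle\Psi\,\Box\,\Phi,\lambda\rangle=\langle\Psi,\Phi\cdot\lambda\rangle,\qquad \langle\Phi\cdot\lambda,a\rangle=\langle\Phi,\lambda\cdot a\rangle,\qquad \langle\lambda\cdot a,b\rangle=\langle\lambda,ab\rangle$$ for $\Phi,\Psi\in A''$, $\lambda\in A'$ and $a,b\in A$. Then, for every weight $\omega$ on $\mathbb{Z}$, the Jacobson radical of the algebra $(\ell^1(\mathbb{Z},\omega)'',\Box)$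 is non-zero: $$\operatorname{rad}\bigl(\ell^1(\mathbb{Z},\omega)'',\Box\bigr)\neq\{0\}.$$ That is, $\ell^1(\mathbb{Z},\omega)''$ is never semisimple. -/

import Mathlib

noncomputable section

namespace Beurling

/-- A weight on `ℤ`: a submultiplicative function `ω : ℤ → [1, ∞)` with `ω 0 = 1`. -/
structure Weight where
  toFun : ℤ → ℝ
  one_le : ∀ n, 1 ≤ toFun n
  map_zero : toFun 0 = 1
  map_add_le : ∀ m n, toFun (m + n) ≤ toFun m * toFun n

instance : CoeFun Weight (fun _ => ℤ → ℝ) := ⟨Weight.toFun⟩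

theorem Weight.nonneg (ω : Weight) (n : ℤ) : 0 ≤ ω n := zero_le_one.trans (ω.one_le n)

/-- The complex functions `f` on `ℤ` with `∑ |f n| ω n < ∞`, as a space of functions. -/
def l1Submodule (ω : Weight) : Submodule ℂ (ℤ → ℂ) where
  carrier := {f | Summable fun n => ‖f n‖ * ω n}
  zero_mem' := by simp [summable_zero]
  add_mem' := by
    intro f g hf hg
    refine Summable.of_nonneg_of_le (fun n => mul_nonneg (norm_nonneg _) (ω.nonneg n)) ?_
      (hf.add hg)
    intro n
    rw [← add_mul]
    exact mul_le_mul_of_nonneg_right (norm_add_le _ _) (ω.nonneg n)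
  smul_mem' := by
    intro c f hf
    simpa [mul_assoc] using Summable.mul_left ‖c‖ hf

/-- The Beurling algebra `ℓ¹(ℤ, ω)`. -/
def L1 (ω : Weight) : Type := l1Submodule ω

namespace L1

variable {ω : Weight}

instance : AddCommGroup (L1 ω) := inferInstanceAs (AddCommGroup (l1Submodule ω))

instance : Module ℂ (L1 ω) := inferInstanceAs (Module ℂ (l1Submodule ω))

instance : CoeFun (L1 ω) (fun _ => ℤ → ℂ) := ⟨fun f => f.1⟩

theorem ext {f g : L1 ω} (h : ∀ n, f n = g n) : f = g := Subtype.ext (funext h)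

theorem summable (f : L1 ω) : Summable fun n => ‖f n‖ * ω n := f.2

theorem zero_apply (n : ℤ) : (0 : L1 ω) n = 0 := rfl

theorem add_apply (f g : L1 ω) (n : ℤ) : (f + g) n = f n + g n := rfl

theorem smul_apply (c : ℂ) (f : L1 ω) (n : ℤ) : (c • f) n = c * f n := rfl

/-- The norm `‖f‖_ω = ∑ |f n| ω n`. -/
instance : Norm (L1 ω) := ⟨fun f => ∑' n, ‖f n‖ * ω n⟩

theorem norm_def (f : L1 ω) : ‖f‖ = ∑' n, ‖f n‖ * ω n := rfl

theorem normedSpaceCore (ω : Weight) : NormedSpace.Core ℂ (L1 ω) where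
  norm_nonneg f := tsum_nonneg fun n => mul_nonneg (norm_nonneg _) (ω.nonneg n)
  norm_smul c f := by
    simp only [norm_def, smul_apply, norm_mul, mul_assoc, tsum_mul_left]
  norm_triangle f g := by
    rw [norm_def, norm_def, norm_def, ← f.summable.tsum_add g.summable]
    refine (f + g).summable.tsum_le_tsum (fun n => ?_) (f.summable.add g.summable)
    rw [← add_mul]
    exact mul_le_mul_of_nonneg_right (norm_add_le _ _) (ω.nonneg n)
  norm_eq_zero_iff f := by
    constructor
    · intro h
      have h0 := (hasSum_zero_iff_of_nonneg
        (fun n => mul_nonneg (norm_nonneg (f n)) (ω.nonneg n))).1 (by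
          have h1 := f.summable.hasSum
          rwa [← norm_def, h] at h1)
      refine ext fun n => ?_
      have hn : ‖f n‖ * ω n = 0 := congrFun h0 n
      have hw : ω n ≠ 0 := (zero_lt_one.trans_le (ω.one_le n)).ne'
      exact norm_eq_zero.1 ((mul_eq_zero.1 hn).resolve_right hw)
    · rintro rfl
      simp [norm_def, zero_apply]

instance : NormedAddCommGroup (L1 ω) := NormedAddCommGroup.ofCore (normedSpaceCore ω)

instance : NormedSpace ℂ (L1 ω) := NormedSpace.ofCore (normedSpaceCore ω)

theorem norm_apply_mul_le (f : L1 ω) (n : ℤ) : ‖f n‖ * ω n ≤ ‖f‖ :=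
  f.summable.le_tsum n fun m _ => mul_nonneg (norm_nonneg _) (ω.nonneg m)

theorem norm_apply_le (f : L1 ω) (n : ℤ) : ‖f n‖ ≤ ‖f‖ :=
  (le_mul_of_one_le_right (norm_nonneg _) (ω.one_le n)).trans (f.norm_apply_mul_le n)

/-- The bijection `(n, m) ↦ (m, n - m)` of `ℤ × ℤ`. -/
def shear : ℤ × ℤ ≃ ℤ × ℤ where
  toFun p := (p.2, p.1 - p.2)
  invFun p := (p.1 + p.2, p.1)
  left_inv p := by ext <;> simp
  right_inv p := by ext <;> simp

theorem hasSum_weighted (f g : L1 ω) :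
    HasSum (fun p : ℤ × ℤ => (‖f p.2‖ * ω p.2) * (‖g (p.1 - p.2)‖ * ω (p.1 - p.2)))
      (‖f‖ * ‖g‖) := by
  have h : HasSum (fun p : ℤ × ℤ => (‖f p.1‖ * ω p.1) * (‖g p.2‖ * ω p.2)) (‖f‖ * ‖g‖) :=
    HasSum.mul f.summable.hasSum g.summable.hasSum
      (f.summable.mul_of_nonneg g.summable
        (Pi.le_def.2 fun n => mul_nonneg (norm_nonneg (f n)) (ω.nonneg n))
        (Pi.le_def.2 fun n => mul_nonneg (norm_nonneg (g n)) (ω.nonneg n)))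
  have h2 := shear.hasSum_iff.2 h
  simpa only [shear, Function.comp_def, Equiv.coe_fn_mk] using h2

theorem norm_mul_weight_le (f g : L1 ω) (n m : ℤ) :
    ‖f m * g (n - m)‖ * ω n ≤ (‖f m‖ * ω m) * (‖g (n - m)‖ * ω (n - m)) := by
  have h := ω.map_add_le m (n - m)
  rw [add_sub_cancel] at h
  rw [norm_mul]
  calc ‖f m‖ * ‖g (n - m)‖ * ω n ≤ ‖f m‖ * ‖g (n - m)‖ * (ω m * ω (n - m)) :=
        mul_le_mul_of_nonneg_left h (mul_nonneg (norm_nonneg _) (norm_nonneg _))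
    _ = _ := by ring

theorem summable_norm_mul_weight (f g : L1 ω) :
    Summable fun p : ℤ × ℤ => ‖f p.2 * g (p.1 - p.2)‖ * ω p.1 :=
  Summable.of_nonneg_of_le (fun _ => mul_nonneg (norm_nonneg _) (ω.nonneg _))
    (fun p => norm_mul_weight_le f g p.1 p.2) (hasSum_weighted f g).summable

theorem summable_norm_mul (f g : L1 ω) :
    Summable fun p : ℤ × ℤ => ‖f p.2 * g (p.1 - p.2)‖ :=
  Summable.of_nonneg_of_le (fun _ => norm_nonneg _)
    (fun _ => le_mul_of_one_le_right (norm_nonneg _) (ω.one_le _))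
    (summable_norm_mul_weight f g)

theorem summable_conv (f g : L1 ω) (n : ℤ) : Summable fun m => f m * g (n - m) :=
  ((summable_norm_mul f g).prod_factor n).of_norm

theorem norm_conv_le (f g : L1 ω) (n : ℤ) :
    ‖∑' m, f m * g (n - m)‖ * ω n ≤ ∑' m, ‖f m * g (n - m)‖ * ω n := by
  rw [tsum_mul_right]
  exact mul_le_mul_of_nonneg_right
    (norm_tsum_le_tsum_norm ((summable_norm_mul f g).prod_factor n)) (ω.nonneg n)

/-- Convolution. -/
instance : Mul (L1 ω) where
  mul f g := ⟨fun n => ∑' m, f m * g (n - m),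
    Summable.of_nonneg_of_le (fun n => mul_nonneg (norm_nonneg _) (ω.nonneg n))
      (norm_conv_le f g) (summable_norm_mul_weight f g).prod⟩

theorem mul_apply (f g : L1 ω) (n : ℤ) : (f * g) n = ∑' m, f m * g (n - m) := rfl

/-- The point mass at `0`. -/
instance : One (L1 ω) where
  one := ⟨Pi.single 0 1, summable_of_ne_finset_zero (s := {0}) (by
    intro n hn
    simp [Pi.single_eq_of_ne (Finset.notMem_singleton.1 hn)])⟩

theorem one_apply (n : ℤ) : (1 : L1 ω) n = (Pi.single 0 1 : ℤ → ℂ) n := rfl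

protected theorem mul_comm (f g : L1 ω) : f * g = g * f := by
  refine ext fun n => ?_
  rw [mul_apply, mul_apply, ← (Equiv.subLeft n).tsum_eq]
  simp [mul_comm]

protected theorem mul_add (f g h : L1 ω) : f * (g + h) = f * g + f * h := by
  refine ext fun n => ?_
  simp only [mul_apply, add_apply, mul_add]
  exact (summable_conv f g n).tsum_add (summable_conv f h n)

protected theorem one_mul (f : L1 ω) : 1 * f = f := by
  refine ext fun n => ?_
  rw [mul_apply, tsum_eq_single 0]
  · simp [one_apply]
  · intro m hm
    simp [one_apply, hm]

protected theorem mul_assoc (f g h : L1 ω) : f * g * h = f * (g * h) := by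
  refine ext fun n => ?_
  have hs : Summable fun p : ℤ × ℤ => f p.2 * g (p.1 - p.2) * h (n - p.1) := by
    refine Summable.of_norm_bounded ((summable_norm_mul f g).mul_right ‖h‖) fun p => ?_
    rw [norm_mul]
    exact mul_le_mul_of_nonneg_left (h.norm_apply_le _) (norm_nonneg _)
  calc (f * g * h) n = ∑' m, ∑' k, f k * g (m - k) * h (n - m) := by
        simp only [mul_apply, tsum_mul_right]
    _ = ∑' k, ∑' m, f k * g (m - k) * h (n - m) :=
        Summable.tsum_comm (f := fun k m => f k * g (m - k) * h (n - m)) hs.prod_symm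
    _ = ∑' k, ∑' j, f k * g j * h (n - k - j) := by
        refine tsum_congr fun k => ?_
        rw [← (Equiv.addRight k).tsum_eq]
        refine tsum_congr fun j => ?_
        simp only [Equiv.coe_addRight, add_sub_cancel_right]
        rw [add_comm j k, sub_sub]
    _ = (f * (g * h)) n := by
        simp only [mul_apply, ← tsum_mul_left, mul_assoc]

protected theorem norm_mul_le (f g : L1 ω) : ‖f * g‖ ≤ ‖f‖ * ‖g‖ := by
  have hs := summable_norm_mul_weight f g
  calc ‖f * g‖ ≤ ∑' n, ∑' m, ‖f m * g (n - m)‖ * ω n :=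
        (f * g).summable.tsum_le_tsum (norm_conv_le f g) hs.prod
    _ = ∑' p : ℤ × ℤ, ‖f p.2 * g (p.1 - p.2)‖ * ω p.1 := hs.tsum_prod.symm
    _ ≤ ‖f‖ * ‖g‖ := by
        rw [← (hasSum_weighted f g).tsum_eq]
        exact hs.tsum_le_tsum (fun p => norm_mul_weight_le f g p.1 p.2)
          (hasSum_weighted f g).summable

instance : NormedCommRing (L1 ω) where
  __ := (inferInstance : NormedAddCommGroup (L1 ω))
  mul_comm := L1.mul_comm
  mul_assoc := L1.mul_assoc
  one_mul := L1.one_mul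
  mul_one f := by rw [L1.mul_comm, L1.one_mul]
  left_distrib := L1.mul_add
  right_distrib f g h := by
    rw [L1.mul_comm, L1.mul_add, L1.mul_comm h f, L1.mul_comm h g]
  zero_mul f := by
    refine ext fun n => ?_
    simp [mul_apply, zero_apply]
  mul_zero f := by
    refine ext fun n => ?_
    simp [mul_apply, zero_apply]
  norm_mul_le := L1.norm_mul_le

instance : NormedAlgebra ℂ (L1 ω) where
  __ := Algebra.ofModule (R := ℂ) (A := L1 ω)
    (fun c f g => by
      refine ext fun n => ?_
      simp only [mul_apply, smul_apply, mul_assoc, tsum_mul_left])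
    (fun c f g => by
      refine ext fun n => ?_
      simp only [mul_apply, smul_apply, mul_left_comm _ c, tsum_mul_left])
  norm_smul_le := norm_smul_le

end L1

end Beurling

/-- The bidual `A''` of a complex normed algebra `A`, carrying the first Arens product. -/
def ArensBidual (A : Type*) [NormedRing A] [NormedAlgebra ℂ A] : Type _ :=
  StrongDual ℂ (StrongDual ℂ A)

namespace ArensBidual

variable {A : Type*} [NormedRing A] [NormedAlgebra ℂ A]

instance : NormedAddCommGroup (ArensBidual A) :=
  inferInstanceAs (NormedAddCommGroup (StrongDual ℂ (StrongDual ℂ A)))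

instance : NormedSpace ℂ (ArensBidual A) :=
  inferInstanceAs (NormedSpace ℂ (StrongDual ℂ (StrongDual ℂ A)))

instance : FunLike (ArensBidual A) (StrongDual ℂ A) ℂ :=
  inferInstanceAs (FunLike (StrongDual ℂ (StrongDual ℂ A)) (StrongDual ℂ A) ℂ)

theorem ext {Φ Ψ : ArensBidual A} (h : ∀ l, Φ l = Ψ l) : Φ = Ψ := DFunLike.ext _ _ h

theorem add_apply (Φ Ψ : ArensBidual A) (l : StrongDual ℂ A) : (Φ + Ψ) l = Φ l + Ψ l := rfl

theorem zero_apply (l : StrongDual ℂ A) : (0 : ArensBidual A) l = 0 := rfl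

theorem smul_apply (c : ℂ) (Φ : ArensBidual A) (l : StrongDual ℂ A) :
    (c • Φ) l = c * Φ l := rfl

theorem map_add (Φ : ArensBidual A) (l l' : StrongDual ℂ A) : Φ (l + l') = Φ l + Φ l' :=
  ContinuousLinearMap.map_add (show StrongDual ℂ (StrongDual ℂ A) from Φ) l l'

theorem map_smul (Φ : ArensBidual A) (c : ℂ) (l : StrongDual ℂ A) : Φ (c • l) = c * Φ l :=
  ContinuousLinearMap.map_smul (show StrongDual ℂ (StrongDual ℂ A) from Φ) c l

theorem norm_apply_le (Φ : ArensBidual A) (l : StrongDual ℂ A) : ‖Φ l‖ ≤ ‖Φ‖ * ‖l‖ :=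
  ContinuousLinearMap.le_opNorm (show StrongDual ℂ (StrongDual ℂ A) from Φ) l

/-- The functional `l · a`, given by `⟨l · a, b⟩ = ⟨l, a b⟩`. -/
def dualAct (l : StrongDual ℂ A) (a : A) : StrongDual ℂ A :=
  l.comp (ContinuousLinearMap.mul ℂ A a)

theorem dualAct_apply (l : StrongDual ℂ A) (a b : A) : dualAct l a b = l (a * b) := rfl

theorem norm_dualAct_le (l : StrongDual ℂ A) (a : A) : ‖dualAct l a‖ ≤ ‖l‖ * ‖a‖ :=
  (ContinuousLinearMap.opNorm_comp_le _ _).trans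
    (mul_le_mul_of_nonneg_left (ContinuousLinearMap.opNorm_mul_apply_le ℂ A a) (norm_nonneg _))

/-- The functional `Φ · l`, given by `⟨Φ · l, a⟩ = ⟨Φ, l · a⟩`. -/
def bidualAct (Φ : ArensBidual A) (l : StrongDual ℂ A) : StrongDual ℂ A :=
  LinearMap.mkContinuous
    { toFun := fun a => Φ (dualAct l a)
      map_add' := fun a b => by
        rw [← map_add]
        congr 1
        ext c
        simp [dualAct_apply, add_mul]
      map_smul' := fun c a => by
        rw [RingHom.id_apply, smul_eq_mul, ← map_smul]
        congr 1
        ext b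
        simp [dualAct_apply] }
    (‖Φ‖ * ‖l‖)
    (fun a => by
      rw [mul_assoc]
      exact (norm_apply_le Φ _).trans
        (mul_le_mul_of_nonneg_left (norm_dualAct_le l a) (norm_nonneg _)))

theorem bidualAct_apply (Φ : ArensBidual A) (l : StrongDual ℂ A) (a : A) :
    bidualAct Φ l a = Φ (dualAct l a) := rfl

theorem norm_bidualAct_le (Φ : ArensBidual A) (l : StrongDual ℂ A) :
    ‖bidualAct Φ l‖ ≤ ‖Φ‖ * ‖l‖ :=
  LinearMap.mkContinuous_norm_le _ (mul_nonneg (norm_nonneg _) (norm_nonneg _)) _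

/-- The first Arens product `Ψ □ Φ`, given by `⟨Ψ □ Φ, l⟩ = ⟨Ψ, Φ · l⟩`. -/
def arensMul (Ψ Φ : ArensBidual A) : StrongDual ℂ (StrongDual ℂ A) :=
  LinearMap.mkContinuous
    { toFun := fun l => Ψ (bidualAct Φ l)
      map_add' := fun l l' => by
        rw [← map_add]
        congr 1
        ext a
        rw [_root_.add_apply]
        exact map_add Φ (dualAct l a) (dualAct l' a)
      map_smul' := fun c l => by
        rw [RingHom.id_apply, smul_eq_mul, ← map_smul]
        congr 1
        ext a
        rw [_root_.smul_apply]
        exact map_smul Φ c (dualAct l a) }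
    (‖Ψ‖ * ‖Φ‖)
    (fun l => by
      rw [mul_assoc]
      exact (norm_apply_le Ψ _).trans
        (mul_le_mul_of_nonneg_left (norm_bidualAct_le Φ l) (norm_nonneg _)))

theorem norm_arensMul_le (Ψ Φ : ArensBidual A) : ‖arensMul Ψ Φ‖ ≤ ‖Ψ‖ * ‖Φ‖ :=
  LinearMap.mkContinuous_norm_le _ (mul_nonneg (norm_nonneg _) (norm_nonneg _)) _

instance : Mul (ArensBidual A) := ⟨arensMul⟩

theorem mul_apply (Ψ Φ : ArensBidual A) (l : StrongDual ℂ A) :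
    (Ψ * Φ) l = Ψ (bidualAct Φ l) := rfl

/-- The image of `1` under the canonical embedding of `A` in its bidual. -/
instance : One (ArensBidual A) := ⟨NormedSpace.inclusionInDoubleDual ℂ A 1⟩

theorem one_apply (l : StrongDual ℂ A) : (1 : ArensBidual A) l = l 1 := rfl

theorem bidualAct_mul (Ψ Φ : ArensBidual A) (l : StrongDual ℂ A) :
    bidualAct (Ψ * Φ) l = bidualAct Ψ (bidualAct Φ l) := by
  ext a
  rw [bidualAct_apply, bidualAct_apply, mul_apply]
  congr 1
  ext b
  rw [bidualAct_apply, dualAct_apply, bidualAct_apply]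
  congr 1
  ext c
  simp only [dualAct_apply, mul_assoc]

instance : NormedRing (ArensBidual A) where
  __ := (inferInstance : NormedAddCommGroup (ArensBidual A))
  mul_assoc Φ Ψ Θ := by
    refine ext fun l => ?_
    rw [mul_apply, mul_apply, mul_apply, bidualAct_mul]
  one_mul Φ := by
    refine ext fun l => ?_
    rw [mul_apply, one_apply, bidualAct_apply]
    congr 1
    ext a
    rw [dualAct_apply, one_mul]
  mul_one Φ := by
    refine ext fun l => ?_
    rw [mul_apply]
    congr 1
    ext a
    rw [bidualAct_apply, one_apply, dualAct_apply, mul_one]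
  left_distrib Φ Ψ Θ := by
    refine ext fun l => ?_
    rw [add_apply, mul_apply, mul_apply, mul_apply, ← map_add]
    rfl
  right_distrib Φ Ψ Θ := rfl
  zero_mul Φ := rfl
  mul_zero Φ := by
    refine ext fun l => ?_
    have h : bidualAct (0 : ArensBidual A) l = (0 : ℂ) • l := by
      ext a
      rw [_root_.smul_apply, zero_smul]
      rfl
    rw [mul_apply, h, map_smul, zero_mul, zero_apply]
  norm_mul_le := norm_arensMul_le

instance : NormedAlgebra ℂ (ArensBidual A) where
  __ := Algebra.ofModule (R := ℂ) (A := ArensBidual A)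
    (fun c Φ Ψ => rfl)
    (fun c Φ Ψ => by
      refine ext fun l => ?_
      rw [smul_apply, mul_apply, mul_apply, ← map_smul]
      rfl)
  norm_smul_le := norm_smul_le

end ArensBidual

end

/-! Let ρ = lim ω(n)^{1/n} as n → +∞. By Fekete's lemma this is also the infimum, so χ : n ↦ ρⁿ is a
character bounded by ω, and v(n) = ω(n)/ρⁿ is at least 1 and subexponential on ℕ. Put T(N) = ∑_{n<N}
v(n). The averages T(N)⁻¹ ∑_{n<N} ρ⁻ⁿ δₙ lie in the unit ball, and multiplying them by δ₁ is
multiplying by ρ up to an error ρ(v(N)+1)/T(N). Subexponential growth makes this error vanish along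
some sequence N_k, and a weak-* limit M then satisfies Ψ □ M = Ψ(χ) M for every Ψ
(`exists_shift_eigen`, `mul_eq_smul_of_shift`).

If moreover M(χ) = 0, every Ψ □ M squares to zero, so M is in the radical. One M may have M(χ) ≠ 0,
but two linearly independent ones always yield a non-zero combination killed by χ
(`jacobson_ne_bot_of_eigen`). To get two, N_k is chosen so sparse that almost all of T(N_{k+1})
comes from the block [N_k, N_{k+1}); limits along even and odd k then concentrate on disjoint
families of blocks, which ω restricted to one family detects. -/

open Filter Topology

/-! ### Weak-* limits and a criterion for the radical -/

/-- A norm-bounded sequence has a weak-* limit in the bidual along every ultrafilter. -/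
theorem exists_bidual_tendsto_ultrafilter {ι E : Type*} [NormedAddCommGroup E] [NormedSpace ℂ E]
    (U : Ultrafilter ι) (x : ι → E) (C : ℝ) (hx : ∀ i, ‖x i‖ ≤ C) :
    ∃ M : StrongDual ℂ (StrongDual ℂ E),
      ∀ l : StrongDual ℂ E, Tendsto (fun i => l (x i)) U (𝓝 (M l)) := by
  let y : ι → WeakDual ℂ (StrongDual ℂ E) := fun i =>
    StrongDual.toWeakDual (NormedSpace.inclusionInDoubleDual ℂ E (x i))
  have hK := WeakDual.isCompact_closedBall (𝕜 := ℂ) (E := StrongDual ℂ E) 0 C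
  obtain ⟨M, -, hM⟩ := hK.ultrafilter_le_nhds (U.map y) (by
    rw [le_principal_iff]
    refine Filter.mem_map.2 (Filter.univ_mem' fun i => ?_)
    simpa [y] using (NormedSpace.double_dual_bound ℂ E (x i)).trans (hx i))
  exact ⟨WeakDual.toStrongDual M, fun l => ((WeakDual.eval_continuous l).tendsto M).comp hM⟩

/-- As (yx)² = 0, the element 1 + yx has inverse 1 - yx for every y. -/
theorem Ring.mem_jacobson_of_mul_mul_self_eq_zero {R : Type*} [Ring R] {x : R}
    (h : ∀ y : R, y * x * (y * x) = 0) : x ∈ Ring.jacobson R := by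
  rw [← Ideal.jacobson_bot, Ideal.mem_jacobson_iff]
  refine fun y => ⟨1 - y * x, ?_⟩
  rw [Ideal.mem_bot, mul_assoc, sub_mul, h]
  noncomm_ring

/-! ### Partial sums of subexponential sequences -/

/-- If `v ≥ 1` grows subexponentially, its partial sums eventually outgrow `v` along a
subsequence. -/
theorem exists_mul_le_sum_range {v : ℕ → ℝ} (h1 : ∀ n, 1 ≤ v n)
    (hv : ∀ r : ℝ, 1 < r → ∀ᶠ n in atTop, v n ≤ r ^ n) (C : ℝ) (hC : 0 < C) (m : ℕ) :
    ∃ N, m < N ∧ C * v N ≤ ∑ n ∈ Finset.range N, v n ∧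
      C * ∑ n ∈ Finset.range m, v n ≤ ∑ n ∈ Finset.range N, v n := by
  set T : ℕ → ℝ := fun N => ∑ n ∈ Finset.range N, v n with hT
  have hTN : ∀ N : ℕ, (N : ℝ) ≤ T N := fun N => by
    simpa using Finset.card_nsmul_le_sum (Finset.range N) v 1 fun n _ => h1 n
  -- Since T(N) ≥ N, the last inequality is automatic for N ≥ K; only C v(N) ≤ T(N) can fail beyond
  -- N₁.
  obtain ⟨K, hK⟩ := exists_nat_ge (C * T m)
  by_contra! hcon
  set N₁ := max K (m + 1) with hN₁
  have hlt : ∀ N, N₁ ≤ N → T N < C * v N := fun N hN => by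
    by_contra! hle
    refine (hcon N ((Nat.lt_succ_self m).trans_le ((le_max_right _ _).trans hN)) hle).not_ge
      (hK.trans (le_trans ?_ (hTN N)))
    exact_mod_cast (le_max_left _ _).trans hN
  -- T(N) < C v(N) = C (T(N+1) - T(N)) makes T grow by at least the factor q at each step.
  set q : ℝ := 1 + C⁻¹ with hq
  have hC' : 0 < C⁻¹ := inv_pos.2 hC
  have hgrow : ∀ j, q ^ j ≤ T (N₁ + j) := by
    intro j
    induction j with
    | zero =>
      refine le_trans ?_ (hTN _)
      have : 1 ≤ N₁ := (Nat.le_add_left 1 m).trans (le_max_right _ _)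
      simpa using this
    | succ j ih =>
      have h2 : T (N₁ + (j + 1)) = T (N₁ + j) + v (N₁ + j) := Finset.sum_range_succ _ _
      have h3 : C⁻¹ * T (N₁ + j) ≤ v (N₁ + j) := by
        rw [inv_mul_le_iff₀ hC]
        exact (hlt _ (Nat.le_add_right _ _)).le
      rw [h2, pow_succ, hq]
      have h4 : q ^ j * (1 + C⁻¹) ≤ T (N₁ + j) * (1 + C⁻¹) :=
        mul_le_mul_of_nonneg_right ih (by positivity)
      rw [hq] at h4
      linarith
  -- Any r strictly between 1 and q works: q^j ≤ T(N₁+j) < C v(N₁+j) ≤ C r^(N₁+j) fails for large j.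
  set r : ℝ := 1 + C⁻¹ / 2 with hr
  have hr1 : 1 < r := by rw [hr]; linarith [half_pos hC']
  have hr0 : 0 < r := zero_lt_one.trans hr1
  have hqr : 1 < q / r := by rw [one_lt_div hr0, hq, hr]; linarith [half_pos hC']
  have hlim := tendsto_pow_atTop_atTop_of_one_lt hqr
  have hev : ∀ᶠ j : ℕ in atTop, v (N₁ + j) ≤ r ^ (N₁ + j) := by
    have := (tendsto_add_atTop_nat N₁).eventually (hv r hr1)
    simpa only [add_comm] using this
  obtain ⟨j, hj1, hj2⟩ := (hev.and (hlim.eventually_gt_atTop (C * r ^ N₁))).exists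
  rw [div_pow, lt_div_iff₀ (pow_pos hr0 j), mul_assoc, ← pow_add] at hj2
  have h5 := hlt (N₁ + j) (Nat.le_add_right _ _)
  have h6 := mul_le_mul_of_nonneg_left hj1 hC.le
  linarith [hgrow j]

/-- The first bound makes the averages asymptotically invariant; the second makes each block
dominate everything before it. -/
theorem exists_strictMono_sum_range {v : ℕ → ℝ} (h1 : ∀ n, 1 ≤ v n)
    (hv : ∀ r : ℝ, 1 < r → ∀ᶠ n in atTop, v n ≤ r ^ n) :
    ∃ N : ℕ → ℕ, StrictMono N ∧
      (∀ k : ℕ, (k + 1) * v (N k) ≤ ∑ n ∈ Finset.range (N k), v n) ∧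
      (∀ k : ℕ, (k + 1) * ∑ n ∈ Finset.range (N k), v n ≤ ∑ n ∈ Finset.range (N (k + 1)), v n) ∧
      ∀ k : ℕ, ((k : ℝ) + 1) ≤ ∑ n ∈ Finset.range (N k), v n := by
  choose g hg1 hg2 hg3 using fun (k m : ℕ) =>
    exists_mul_le_sum_range h1 hv ((k : ℝ) + 1) (by positivity) m
  let N : ℕ → ℕ := fun k => Nat.rec (g 0 0) (fun k m => g (k + 1) m) k
  have hmono : StrictMono N := strictMono_nat_of_lt_succ fun k => hg1 (k + 1) (N k)
  have hA : ∀ k : ℕ, (k + 1) * v (N k) ≤ ∑ n ∈ Finset.range (N k), v n := by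
    intro k
    cases k with
    | zero => exact hg2 0 0
    | succ k => exact hg2 (k + 1) (N k)
  refine ⟨N, hmono, hA, fun k => ?_, fun k => ?_⟩
  · refine le_trans ?_ (hg3 (k + 1) (N k))
    refine mul_le_mul_of_nonneg_right ?_ (Finset.sum_nonneg fun n _ => zero_le_one.trans (h1 n))
    push_cast
    linarith
  · exact (le_mul_of_one_le_right (by positivity) (h1 _)).trans (hA k)

/-! ### Growth rate of a weight -/

namespace Beurling

theorem Weight.pos (ω : Weight) (n : ℤ) : 0 < ω n := zero_lt_one.trans_le (ω.one_le n)

/-- The growth rate of a weight at `+∞`: `ρ` is the limit, and the infimum, of `ω(n)^{1/n}`. -/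
theorem Weight.exists_growth_rate (ω : Weight) : ∃ ρ : ℝ, 0 < ρ ∧ (∀ n : ℤ, ρ ^ n ≤ ω n) ∧
    ∀ r : ℝ, 1 < r → ∀ᶠ n : ℕ in atTop, ω n ≤ (r * ρ) ^ n := by
  have hsub : Subadditive fun n : ℕ => Real.log (ω n) := fun m n => by
    rw [← Real.log_mul (ω.pos _).ne' (ω.pos _).ne']
    refine Real.log_le_log (ω.pos _) ?_
    push_cast
    exact ω.map_add_le _ _
  have hbdd : BddBelow (Set.range fun n : ℕ => Real.log (ω n) / n) :=
    ⟨0, by rintro _ ⟨n, rfl⟩; exact div_nonneg (Real.log_nonneg (ω.one_le _)) n.cast_nonneg⟩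
  have hlim := hsub.tendsto_lim hbdd
  have hL : 0 ≤ hsub.lim := ge_of_tendsto' hlim fun n =>
    div_nonneg (Real.log_nonneg (ω.one_le _)) n.cast_nonneg
  refine ⟨Real.exp hsub.lim, Real.exp_pos _, fun n => ?_, fun r hr => ?_⟩
  · rcases n with n | n
    · rw [Int.ofNat_eq_natCast, zpow_natCast, ← Real.exp_nat_mul, ← Real.le_log_iff_exp_le (ω.pos _)]
      rcases Nat.eq_zero_or_pos n with rfl | hn
      · simpa using Real.log_nonneg (ω.one_le _)
      · have := hsub.lim_le_div hbdd hn.ne'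
        rwa [le_div_iff₀ (Nat.cast_pos.2 hn), mul_comm] at this
    -- Here ρ ≥ 1, because ω ≥ 1; hence negative powers of ρ are at most 1 ≤ ω.
    · rw [zpow_negSucc]
      exact (inv_le_one_of_one_le₀ (one_le_pow₀ (Real.one_le_exp hL))).trans (ω.one_le _)
  · have hr0 : 0 < r := zero_lt_one.trans hr
    have hlt : hsub.lim < Real.log r + hsub.lim := by linarith [Real.log_pos hr]
    filter_upwards [hlim.eventually_lt_const hlt, eventually_gt_atTop 0] with n hn hn0
    rw [div_lt_iff₀ (Nat.cast_pos.2 hn0), mul_comm] at hn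
    rw [← Real.exp_log hr0, ← Real.exp_add, ← Real.exp_nat_mul, ← Real.log_le_iff_le_exp (ω.pos _)]
    exact hn.le

/-! ### Point masses and functionals on the Beurling algebra -/

namespace L1

variable {ω : Weight}

/-- The element `c δₙ` of `ℓ¹(ℤ, ω)`. -/
def single (n : ℤ) (c : ℂ) : L1 ω :=
  ⟨Pi.single n c, summable_of_ne_finset_zero (s := {n}) (by
    intro m hm
    simp [Pi.single_eq_of_ne (Finset.notMem_singleton.1 hm)])⟩

theorem single_apply (n : ℤ) (c : ℂ) (m : ℤ) : (single n c : L1 ω) m = if m = n then c else 0 :=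
  Pi.single_apply n c m

theorem norm_single (n : ℤ) (c : ℂ) : ‖(single n c : L1 ω)‖ = ‖c‖ * ω n := by
  rw [norm_def, tsum_eq_single n]
  · simp [single_apply]
  · intro m hm
    simp [single_apply, hm]

theorem smul_single (n : ℤ) (a c : ℂ) : a • (single n c : L1 ω) = single n (a * c) :=
  ext fun m => by simp [smul_apply, single_apply]

theorem single_mul_single (m n : ℤ) (a b : ℂ) :
    (single m a * single n b : L1 ω) = single (m + n) (a * b) := by
  refine ext fun k => ?_
  rw [mul_apply, tsum_eq_single m]
  · simp [single_apply, sub_eq_iff_eq_add']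
  · intro j hj
    simp [single_apply, hj]

theorem one_eq_single : (1 : L1 ω) = single 0 1 := rfl

/-- Evaluation at an integer, as a linear map. -/
def evalₗ (n : ℤ) : L1 ω →ₗ[ℂ] ℂ where
  toFun f := f n
  map_add' _ _ := rfl
  map_smul' _ _ := rfl

theorem evalₗ_apply (n : ℤ) (f : L1 ω) : evalₗ n f = f n := rfl

theorem sub_sum_single_apply (f : L1 ω) (s : Finset ℤ) (m : ℤ) :
    (f - ∑ n ∈ s, single n (f n) : L1 ω) m = if m ∈ s then 0 else f m := by
  rw [← evalₗ_apply, map_sub, map_sum]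
  simp only [evalₗ_apply, single_apply, Finset.sum_ite_eq]
  split_ifs
  · exact sub_self _
  · exact sub_zero _

theorem hasSum_single (f : L1 ω) : HasSum (fun n => single n (f n)) f := by
  rw [HasSum, SummationFilter.unconditional_filter, tendsto_iff_norm_sub_tendsto_zero]
  refine (tendsto_tsum_compl_atTop_zero fun n => ‖f n‖ * ω n).congr fun s => ?_
  rw [norm_sub_rev, norm_def, ← tsum_subtype_eq_of_support_subset (s := {n | n ∉ s})]
  · refine tsum_congr fun n => ?_
    rw [sub_sum_single_apply, if_neg n.2]
  · intro n hn hns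
    refine hn ?_
    simp only [sub_sum_single_apply, if_pos hns, norm_zero, zero_mul]

/-- Point masses span a dense subspace, by `hasSum_single`. -/
theorem dual_ext {l l' : StrongDual ℂ (L1 ω)} (h : ∀ n, l (single n 1) = l' (single n 1)) :
    l = l' := by
  have h' : ∀ n c, l (single n c) = l' (single n c) := fun n c => by
    rw [← mul_one c, ← smul_single, l.map_smul, l'.map_smul, h]
  ext f
  have h1 := (hasSum_single f).mapL l
  have h2 := (hasSum_single f).mapL l'
  simp only [h'] at h1
  exact h1.unique h2

theorem norm_mul_le_of_bound {g : ℤ → ℂ} (hg : ∀ n, ‖g n‖ ≤ ω n) (f : L1 ω) (n : ℤ) :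
    ‖f n * g n‖ ≤ ‖f n‖ * ω n := by
  rw [norm_mul]
  exact mul_le_mul_of_nonneg_left (hg n) (norm_nonneg _)

/-- The functional `f ↦ ∑ f(n) g(n)` given by a function `g` with `|g| ≤ ω`. -/
noncomputable def pairing (g : ℤ → ℂ) (hg : ∀ n, ‖g n‖ ≤ ω n) : StrongDual ℂ (L1 ω) :=
  LinearMap.mkContinuous
    { toFun := fun f => ∑' n, f n * g n
      map_add' := fun f f' => by
        simp only [add_apply, add_mul]
        exact (Summable.of_norm_bounded f.summable (norm_mul_le_of_bound hg f)).tsum_add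
          (Summable.of_norm_bounded f'.summable (norm_mul_le_of_bound hg f'))
      map_smul' := fun c f => by
        simp only [smul_apply, mul_assoc, tsum_mul_left, RingHom.id_apply, smul_eq_mul] }
    1
    (fun f => by
      rw [one_mul]
      exact tsum_of_norm_bounded f.summable.hasSum (norm_mul_le_of_bound hg f))

theorem pairing_single (g : ℤ → ℂ) (hg : ∀ n, ‖g n‖ ≤ ω n) (n : ℤ) (c : ℂ) :
    pairing g hg (single n c : L1 ω) = c * g n := by
  change ∑' m, (single n c : L1 ω) m * g m = _
  rw [tsum_eq_single n]
  · simp [single_apply]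
  · intro m hm
    simp [single_apply, hm]

end L1

end Beurling

/-! ### Eigenvectors of left multiplication in the bidual -/

namespace ArensBidual

variable {A : Type*} [NormedRing A] [NormedAlgebra ℂ A]

theorem dualAct_mul (l : StrongDual ℂ A) (a b : A) :
    dualAct l (a * b) = dualAct (dualAct l a) b := by
  ext c
  simp only [dualAct_apply, mul_assoc]

/-- If `Ψ □ M = Ψ(χ) M` for all `Ψ`, and `M(χ) = 0`, then `M` lies in the radical. -/
theorem mem_jacobson_of_eigen {M : ArensBidual A} {χ : StrongDual ℂ A}
    (hM : ∀ Ψ : ArensBidual A, Ψ * M = Ψ χ • M) (hχ : M χ = 0) :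
    M ∈ Ring.jacobson (ArensBidual A) :=
  Ring.mem_jacobson_of_mul_mul_self_eq_zero fun Ψ => by
    rw [hM Ψ, smul_mul_smul_comm, hM M, hχ, zero_smul, smul_zero]

/-- Two functionals with `Ψ □ M = Ψ(χ) M`, told apart by a pair of test functionals, give a
non-zero element of the radical. -/
theorem jacobson_ne_bot_of_eigen {M M' : ArensBidual A} {χ l l' : StrongDual ℂ A}
    (hM : ∀ Ψ : ArensBidual A, Ψ * M = Ψ χ • M) (hM' : ∀ Ψ : ArensBidual A, Ψ * M' = Ψ χ • M')
    (hl : M l = 1) (hl' : M' l = 1) (hl₁ : M l' = 1) (hl₂ : M' l' = 0) :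
    Ring.jacobson (ArensBidual A) ≠ ⊥ := by
  intro hbot
  have key : ∀ N : ArensBidual A, (∀ Ψ : ArensBidual A, Ψ * N = Ψ χ • N) → N χ = 0 → N = 0 :=
    fun N hN hχ => by simpa [hbot] using mem_jacobson_of_eigen hN hχ
  -- This combination is killed by χ, hence would have to vanish.
  have h := key (M χ • M' - M' χ • M)
    (fun Ψ => by
      rw [mul_sub, mul_smul_comm, mul_smul_comm, hM, hM', smul_sub, smul_comm, smul_comm (M' χ)])
    (by
      change M χ * M' χ - M' χ * M χ = 0
      ring)
  have e : ∀ l, M χ * M' l - M' χ * M l = 0 := fun l => DFunLike.congr_fun h l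
  have e1 := e l'
  have e2 := e l
  rw [hl₁, hl₂] at e1
  rw [hl, hl'] at e2
  -- Testing on l' gives M'(χ) = 0, and on l gives M(χ) = M'(χ). So M itself is killed by χ,
  -- although M(l) = 1.
  have hMχ : M χ = 0 := by linear_combination e2 - e1
  have := key M hM hMχ
  rw [this, zero_apply] at hl
  exact zero_ne_one hl

end ArensBidual

namespace Beurling.L1

open ArensBidual

variable {ω : Weight}

/-- A functional which translation by `1` scales by `ρ` satisfies `Ψ □ M = Ψ(χ) M`, where `χ` is
the character `n ↦ ρⁿ`. -/
theorem mul_eq_smul_of_shift {ρ : ℝ} (hρ : 0 < ρ) {χ : StrongDual ℂ (L1 ω)}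
    (hχ : ∀ n : ℤ, χ (single n 1) = (ρ : ℂ) ^ n) {M : ArensBidual (L1 ω)}
    (hM : ∀ l, M (dualAct l (single 1 1)) = ρ * M l) (Ψ : ArensBidual (L1 ω)) :
    Ψ * M = Ψ χ • M := by
  have hρ' : (ρ : ℂ) ≠ 0 := Complex.ofReal_ne_zero.2 hρ.ne'
  have hstep : ∀ l (n : ℤ), M (dualAct l (single (n + 1) 1)) = ρ * M (dualAct l (single n 1)) := by
    intro l n
    rw [← hM, ← dualAct_mul, single_mul_single, mul_one]
  have hpow : ∀ l (n : ℤ), M (dualAct l (single n 1)) = (ρ : ℂ) ^ n * M l := by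
    intro l n
    induction n using Int.induction_on with
    | zero =>
      rw [← one_eq_single, zpow_zero, one_mul]
      congr 1
      ext a
      rw [dualAct_apply, one_mul]
    | succ n ih => rw [hstep, ih, zpow_add_one₀ hρ']; ring
    | pred n ih =>
      have h := hstep l (-n - 1)
      rw [sub_add_cancel, ih] at h
      rw [zpow_sub_one₀ hρ', mul_right_comm, h, mul_comm (ρ : ℂ), mul_inv_cancel_right₀ hρ']
  refine ArensBidual.ext fun l => ?_
  -- Both sides take the value ρⁿ M(l) at δₙ.
  have hact : bidualAct M l = M l • χ := dual_ext fun n => by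
    rw [bidualAct_apply, hpow, _root_.smul_apply, hχ, smul_eq_mul, mul_comm]
  rw [ArensBidual.mul_apply, hact, ArensBidual.map_smul, ArensBidual.smul_apply, mul_comm]

/-! ### Weighted averages and their limits -/

section average

variable (ω) (ρ : ℝ)

/-- The weight `ω`, restricted to `ℕ` and divided by the character `n ↦ ρⁿ`. -/
noncomputable def quot (n : ℕ) : ℝ := (ρ ^ n)⁻¹ * ω n

/-- The partial sums of `ω(n) / ρⁿ`. -/
noncomputable def quotSum (N : ℕ) : ℝ := ∑ n ∈ Finset.range N, quot ω ρ n

/-- The weighted average of the functionals `ρ⁻ⁿ δₙ` over `0 ≤ n < N`. -/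
noncomputable def average (N : ℕ) : L1 ω :=
  ((quotSum ω ρ N : ℂ)⁻¹) • ∑ n ∈ Finset.range N, single (n : ℤ) ((ρ : ℂ) ^ n)⁻¹

variable {ω} {ρ}

theorem norm_single_inv_pow (hρ : 0 < ρ) (n : ℕ) :
    ‖(single (n : ℤ) ((ρ : ℂ) ^ n)⁻¹ : L1 ω)‖ = quot ω ρ n := by
  rw [norm_single, norm_inv, norm_pow, Complex.norm_real, Real.norm_of_nonneg hρ.le, quot]

theorem quotSum_nonneg (hρ : 0 < ρ) (N : ℕ) : 0 ≤ quotSum ω ρ N :=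
  Finset.sum_nonneg fun n _ => mul_nonneg (by positivity) (ω.nonneg n)

theorem norm_average_le (hρ : 0 < ρ) (N : ℕ) : ‖average ω ρ N‖ ≤ 1 := by
  rw [average, norm_smul, norm_inv, Complex.norm_real, Real.norm_of_nonneg (quotSum_nonneg hρ N)]
  refine (mul_le_mul_of_nonneg_left (norm_sum_le _ _)
    (inv_nonneg.2 (quotSum_nonneg hρ N))).trans ?_
  simp only [norm_single_inv_pow hρ]
  exact inv_mul_le_one

/-- Multiplication by δ₁ sends ρ⁻ⁿ δₙ to ρ times the next such term, so the difference telescopes.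
Only the terms n = N and n = 0 survive, and the latter contributes the 1. -/
theorem norm_single_mul_average_sub_le (hρ : 0 < ρ) (N : ℕ) :
    ‖single 1 1 * average ω ρ N - (ρ : ℂ) • average ω ρ N‖ ≤
      ρ * ((quotSum ω ρ N)⁻¹ * (quot ω ρ N + 1)) := by
  have hρ' : (ρ : ℂ) ≠ 0 := Complex.ofReal_ne_zero.2 hρ.ne'
  let a : ℕ → L1 ω := fun n => (ρ : ℂ) • single (n : ℤ) ((ρ : ℂ) ^ n)⁻¹
  have ha : ∀ n : ℕ, single 1 1 * (single (n : ℤ) ((ρ : ℂ) ^ n)⁻¹ : L1 ω) = a (n + 1) := by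
    intro n
    simp only [a]
    rw [single_mul_single, smul_single, one_mul, add_comm, Nat.cast_succ, pow_succ, mul_inv_rev,
      mul_inv_cancel_left₀ hρ']
  have hna : ∀ n, ‖a n‖ = ρ * quot ω ρ n := fun n => by
    simp only [a]
    rw [norm_smul, norm_single_inv_pow hρ, Complex.norm_real, Real.norm_of_nonneg hρ.le]
  have h0 : quot ω ρ 0 = 1 := by simp [quot, ω.map_zero]
  have hdiff : single 1 1 * average ω ρ N - (ρ : ℂ) • average ω ρ N =
      ((quotSum ω ρ N : ℂ)⁻¹) • (a N - a 0) := by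
    rw [average, mul_smul_comm, smul_comm (ρ : ℂ), ← smul_sub, Finset.mul_sum, Finset.smul_sum,
      ← Finset.sum_sub_distrib, ← Finset.sum_range_sub]
    simp only [ha, a]
  rw [hdiff, norm_smul, norm_inv, Complex.norm_real, Real.norm_of_nonneg (quotSum_nonneg hρ N),
    mul_left_comm]
  refine mul_le_mul_of_nonneg_left ((norm_sub_le _ _).trans_eq ?_)
    (inv_nonneg.2 (quotSum_nonneg hρ N))
  rw [hna, hna, h0]
  ring

open Classical in
/-- The functional given by `ω` restricted to a set of non-negative integers. -/
noncomputable def weightOn (ω : Weight) (B : Set ℕ) : StrongDual ℂ (L1 ω) :=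
  -- `Int.toNat` sends negative n to 0, so negative n are included when 0 ∈ B; this is harmless, as
  -- the averages live on n ≥ 0.
  pairing (fun n => if n.toNat ∈ B then (ω n : ℂ) else 0) fun n => by
    split_ifs
    · rw [Complex.norm_real, Real.norm_of_nonneg (ω.nonneg n)]
    · rw [norm_zero]
      exact ω.nonneg n

open Classical in
theorem weightOn_average (B : Set ℕ) (N : ℕ) :
    weightOn ω B (average ω ρ N) =
      (((quotSum ω ρ N)⁻¹ * ∑ n ∈ Finset.range N with n ∈ B, quot ω ρ n : ℝ) : ℂ) := by
  rw [average, _root_.map_smul, map_sum, smul_eq_mul, Finset.sum_filter]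
  push_cast
  congr 1
  refine Finset.sum_congr rfl fun n _ => ?_
  rw [weightOn, pairing_single, Int.toNat_natCast]
  split_ifs <;> simp [quot]

theorem one_le_quot (hρ : 0 < ρ) (hω : ∀ n : ℤ, ρ ^ n ≤ ω n) (n : ℕ) : 1 ≤ quot ω ρ n := by
  rw [quot, inv_mul_eq_div, one_le_div (pow_pos hρ n)]
  exact_mod_cast hω n

/-- Weak-* limits of averages are eigenvectors of the translation by `1`. -/
theorem exists_shift_eigen (hρ : 0 < ρ) {N : ℕ → ℕ}
    (hN : ∀ k : ℕ, (k + 1) * quot ω ρ (N k) ≤ quotSum ω ρ (N k))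
    (hN' : ∀ k : ℕ, (k : ℝ) + 1 ≤ quotSum ω ρ (N k)) {φ : ℕ → ℕ} (hφ : Tendsto φ atTop atTop) :
    ∃ M : ArensBidual (L1 ω), (∀ l, M (dualAct l (single 1 1)) = ρ * M l) ∧
      ∀ l c, Tendsto (fun k => l (average ω ρ (N (φ k)))) atTop (𝓝 c) → M l = c := by
  -- The ultrafilter is free, so M agrees with every ordinary limit that exists.
  have hU : (hyperfilter ℕ : Filter ℕ) ≤ atTop := Nat.cofinite_eq_atTop ▸ hyperfilter_le_cofinite
  obtain ⟨M, hM⟩ := exists_bidual_tendsto_ultrafilter (hyperfilter ℕ)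
    (fun k => average ω ρ (N (φ k))) 1 fun k => norm_average_le hρ _
  have huniq : ∀ l c, Tendsto (fun k => l (average ω ρ (N (φ k)))) atTop (𝓝 c) → M l = c :=
    fun l c h => tendsto_nhds_unique (hM l) (h.mono_left hU)
  refine ⟨M, fun l => ?_, huniq⟩
  have h1 := (hM (dualAct l (single 1 1))).sub ((hM l).const_mul (ρ : ℂ))
  -- The two boundary terms v(N_k)/T(N_k) and 1/T(N_k) are each at most 1/(k+1).
  have hb : ∀ k, ‖single 1 1 * average ω ρ (N k) - (ρ : ℂ) • average ω ρ (N k)‖ ≤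
      2 * ρ * (1 / ((k : ℝ) + 1)) := by
    intro k
    refine (norm_single_mul_average_sub_le hρ (N k)).trans ?_
    have hk : (0 : ℝ) < k + 1 := by positivity
    have hT : 0 < quotSum ω ρ (N k) := hk.trans_le (hN' k)
    rw [mul_comm 2 ρ, mul_assoc]
    refine mul_le_mul_of_nonneg_left ?_ hρ.le
    rw [inv_mul_eq_div, mul_one_div, div_le_div_iff₀ hT hk]
    linarith [hN k, hN' k]
  have h2 : Tendsto (fun k => dualAct l (single 1 1) (average ω ρ (N (φ k))) -
      ρ * l (average ω ρ (N (φ k)))) atTop (𝓝 0) := by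
    have hz : Tendsto (fun k => ‖l‖ * (2 * ρ * (1 / ((φ k : ℝ) + 1)))) atTop (𝓝 0) := by
      simpa using ((tendsto_one_div_add_atTop_nhds_zero_nat (𝕜 := ℝ)).comp hφ).const_mul
        (2 * ρ) |>.const_mul ‖l‖
    refine squeeze_zero_norm (fun k => ?_) hz
    rw [dualAct_apply, ← smul_eq_mul (ρ : ℂ), ← _root_.map_smul, ← map_sub]
    exact (l.le_opNorm _).trans (mul_le_mul_of_nonneg_left (hb _) (norm_nonneg _))
  exact sub_eq_zero.1 (tendsto_nhds_unique h1 (h2.mono_left hU))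

end average

end Beurling.L1

/-! ### Two independent limits -/

open Beurling Beurling.L1 in
theorem theorem1p1 (ω : Beurling.Weight) :
    Ring.jacobson (ArensBidual (Beurling.L1 ω)) ≠ ⊥ := by
  classical
  obtain ⟨ρ, hρ, hle, hgrow⟩ := ω.exists_growth_rate
  have hq1 := one_le_quot hρ hle
  have hsub : ∀ r : ℝ, 1 < r → ∀ᶠ n : ℕ in atTop, quot ω ρ n ≤ r ^ n := fun r hr => by
    filter_upwards [hgrow r hr] with n hn
    rwa [quot, inv_mul_le_iff₀ (pow_pos hρ n), mul_comm, ← mul_pow]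
  obtain ⟨N, hmono, hN1, hN2, hN3⟩ := exists_strictMono_sum_range hq1 hsub
  have hpos : ∀ k, 0 < quotSum ω ρ (N k) := fun k =>
    (by positivity : (0 : ℝ) < k + 1).trans_le (hN3 k)
  have hratio : ∀ k, (quotSum ω ρ (N (k + 1)))⁻¹ * quotSum ω ρ (N k) ≤ 1 / ((k : ℝ) + 1) := by
    intro k
    rw [inv_mul_eq_div, div_le_div_iff₀ (hpos _) (by positivity), one_mul, mul_comm]
    exact hN2 k
  have hlim := tendsto_one_div_add_atTop_nhds_zero_nat (𝕜 := ℝ)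
  have hodd : Tendsto (fun k : ℕ => 2 * k + 1) atTop atTop :=
    tendsto_atTop_mono (fun k => by rw [id]; omega) tendsto_id
  have heven : Tendsto (fun k : ℕ => 2 * k) atTop atTop :=
    tendsto_atTop_mono (fun k => by rw [id]; omega) tendsto_id
  have heven' : Tendsto (fun k : ℕ => 2 * k + 1 + 1) atTop atTop :=
    tendsto_atTop_mono (fun k => by rw [id]; omega) tendsto_id
  obtain ⟨M, hM, hMlim⟩ := exists_shift_eigen hρ hN1 hN3 heven'
  obtain ⟨M', hM', hMlim'⟩ := exists_shift_eigen hρ hN1 hN3 hodd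
  -- The blocks that end at an even index: averages up to N(2j+2) have just crossed one, averages up
  -- to N(2j+1) stop just before one.
  let B : Set ℕ := {n | ∃ j, N (2 * j + 1) ≤ n ∧ n < N (2 * j + 1 + 1)}
  have hχ : ∀ n : ℤ, pairing (fun n : ℤ => (ρ : ℂ) ^ n) (fun n => by
      rw [norm_zpow, Complex.norm_real, Real.norm_of_nonneg hρ.le]; exact hle n)
      (single n 1 : L1 ω) = (ρ : ℂ) ^ n := fun n => by rw [pairing_single, one_mul]
  have huniv : ∀ k, weightOn ω Set.univ (average ω ρ (N k)) = 1 := fun k => by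
    rw [weightOn_average]
    simp only [Set.mem_univ, Finset.filter_true]
    rw [← quotSum, inv_mul_cancel₀ (hpos k).ne', Complex.ofReal_one]
  refine ArensBidual.jacobson_ne_bot_of_eigen (l := weightOn ω Set.univ) (l' := weightOn ω B)
    (mul_eq_smul_of_shift hρ hχ hM) (mul_eq_smul_of_shift hρ hχ hM')
    (hMlim _ _ ?_) (hMlim' _ _ ?_) (hMlim _ _ ?_) (hMlim' _ _ ?_)
  · simp only [huniv, tendsto_const_nhds]
  · simp only [huniv, tendsto_const_nhds]
  · simp only [weightOn_average]
    rw [← Complex.ofReal_one]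
    refine (Complex.continuous_ofReal.tendsto 1).comp ?_
    have h0 := (hlim.comp hodd).const_sub 1
    rw [sub_zero] at h0
    refine tendsto_of_tendsto_of_tendsto_of_le_of_le h0 tendsto_const_nhds (fun j => ?_) fun j => ?_
    -- The last block [N(2j+1), N(2j+2)) lies in B, so the mass outside B is at most
    -- T(N(2j+1))/T(N(2j+2)).
    · refine (sub_le_sub_left (hratio (2 * j + 1)) 1).trans ?_
      rw [← inv_mul_cancel₀ (hpos (2 * j + 1 + 1)).ne', ← mul_sub]
      refine mul_le_mul_of_nonneg_left ?_ (inv_nonneg.2 (hpos _).le)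
      rw [quotSum, quotSum, ← Finset.sum_Ico_eq_sub _ (hmono (Nat.lt_succ_self _)).le]
      refine Finset.sum_le_sum_of_subset_of_nonneg (fun n hn => ?_) fun n _ _ =>
        zero_le_one.trans (hq1 n)
      rw [Finset.mem_Ico] at hn
      exact Finset.mem_filter.2 ⟨Finset.mem_range.2 hn.2, j, hn.1, hn.2⟩
    · refine (mul_le_mul_of_nonneg_left ?_ (inv_nonneg.2 (hpos _).le)).trans
        (inv_mul_cancel₀ (hpos (2 * j + 1 + 1)).ne').le
      exact Finset.sum_le_sum_of_subset_of_nonneg (Finset.filter_subset _ _) fun n _ _ =>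
        zero_le_one.trans (hq1 n)
  · simp only [weightOn_average]
    rw [← Complex.ofReal_zero]
    refine (Complex.continuous_ofReal.tendsto 0).comp ?_
    refine squeeze_zero (fun j => mul_nonneg (inv_nonneg.2 (hpos _).le)
      (Finset.sum_nonneg fun n _ => zero_le_one.trans (hq1 n))) (fun j => ?_) (hlim.comp heven)
    -- Below N(2j+1), the set B only meets blocks that end by N(2j), so its mass is at most
    -- T(N(2j))/T(N(2j+1)).
    refine le_trans (mul_le_mul_of_nonneg_left ?_ (inv_nonneg.2 (hpos _).le)) (hratio (2 * j))
    refine Finset.sum_le_sum_of_subset_of_nonneg (fun n hn => ?_) fun n _ _ =>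
      zero_le_one.trans (hq1 n)
    obtain ⟨h1, i, hi1, hi2⟩ := Finset.mem_filter.1 hn
    have hij : 2 * i + 1 < 2 * j + 1 := hmono.lt_iff_lt.1 (hi1.trans_lt (Finset.mem_range.1 h1))
    exact Finset.mem_range.2 (hi2.trans_le (hmono.monotone (by omega)))
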